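/- Let $B_n$ denote the Bernoulli numbers, defined by $\frac{x}{e^x-1}=\sum_{n\ge 0}B_n\frac{x^n}{n!}$, and let $v_p$ denote the $p$-adic valuation on $\mathbb{Q}_p$, with $v_p(p)=1$ and $v_p(0)=+\infty$. Let $p$ be an odd prime and let $k$ be an even residue class modulo $p-1$. Then there exist coefficients $a_i(p,k)\in\mathbb{Q}_p$, $i=0,1,2,\ldots$, such that for every non-negative integer $n$ with $n\equiv k \pmod{p-1}$ the series $\sum_{i\ge 0}a_i(p,k)\,n^i$ (with $0^0=1$) converges in $\mathbb{Q}_p$ and $$B_n=(1-p^{n-1})^{-1}\sum_{i\ge 0}a_i(p,k)\,n^i ,$$ and such that the following conditions hold: 1. $a_0(p,k)=1-\frac1p$ if $k\equiv 0\pmod{p-1}$, and $a_0(p,k)=0$ otherwise; 2. $v_p(a_i(p,k))\ge \frac{p-2}{p-1}\,i-2$ for all $i\ge 0$; 3. $v_p(a_i(p,k))\ge i-1$ for all $i\ge 0$ with $p\ge i+2$. -/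

import Mathlib

/-!
Write `ω` for the Teichmüller character and `a = ω(a) + p t(a)` for `0 < a < p`. The
multiplication theorem `pⁿ ∑ Bₙ(a / p) = p Bₙ`, summed over `0 ≤ a < p`, shows
that the terms with `a ≠ 0` contribute `p (1 - pⁿ⁻¹) Bₙ`. Expanding
`Bₙ(t(a) + ω(a) / p) = ∑ (n choose j) Bⱼ(t(a)) (ω(a) / p)ⁿ⁻ʲ` there, and using that `ω(a)ⁿ`
depends only on the residue class `k` of `n` modulo `p - 1`, turns it into a Newton series
`∑ dⱼ n (n - 1) ⋯ (n - j + 1)` with `dⱼ = pʲ⁻¹ / j! ∑ ω(a)ᵏ⁻ʲ Bⱼ(t(a))`.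

By von Staudt–Clausen the character sum has `p`-adic norm at most `p`, and at most `1` if
`j ≤ p - 2`, while Legendre's formula bounds the valuation of `j!`; in particular `dⱼ → 0`, so the
Newton series can be rearranged into a power series `∑ aᵢ nⁱ`. As `aᵢ` is an integral combination
of the `dⱼ` with `j ≥ i`, it inherits their bounds, and `a₀ = d₀` is a sum over the values of `ωᵏ`.
-/

open Filter Finset Topology
open scoped Nat Polynomial PowerSeries

section BernoulliPolynomials

variable {A : Type*} [CommRing A] [Algebra ℚ A]

/-- The exponential generating function `∑ Bₙ(t) Xⁿ / n!` of the Bernoulli polynomials at `t`. -/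
noncomputable def bernoulliPolynomialSeries (t : A) : A⟦X⟧ :=
  .mk fun n => Polynomial.aeval t ((1 / n ! : ℚ) • Polynomial.bernoulli n)

theorem factorial_mul_coeff_bernoulliPolynomialSeries (t : A) (n : ℕ) :
    (n ! : A) * (bernoulliPolynomialSeries t).coeff n =
      Polynomial.aeval t (Polynomial.bernoulli n) := by
  have hn : (n ! : ℚ) ≠ 0 := Nat.cast_ne_zero.2 n.factorial_ne_zero
  rw [bernoulliPolynomialSeries, PowerSeries.coeff_mk, ← nsmul_eq_mul, ← map_nsmul,
    ← Nat.cast_smul_eq_nsmul ℚ, smul_smul, mul_one_div_cancel hn, one_smul]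

theorem exp_sub_one_mul_right_cancel {f g : A⟦X⟧}
    (h : f * (PowerSeries.exp A - 1) = g * (PowerSeries.exp A - 1)) : f = g := by
  apply PowerSeries.mul_X_cancel
  rw [← bernoulliPowerSeries_mul_exp_sub_one, mul_left_comm, h, mul_left_comm]

theorem bernoulliPolynomialSeries_eq_mul_rescale_exp (t : A) :
    bernoulliPolynomialSeries t =
      bernoulliPowerSeries A * PowerSeries.rescale t (PowerSeries.exp A) := by
  apply exp_sub_one_mul_right_cancel
  rw [bernoulliPolynomialSeries, Polynomial.bernoulli_generating_function, mul_right_comm,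
    bernoulliPowerSeries_mul_exp_sub_one]

theorem bernoulliPolynomialSeries_add (x y : A) :
    bernoulliPolynomialSeries (x + y) =
      bernoulliPolynomialSeries x * PowerSeries.rescale y (PowerSeries.exp A) := by
  rw [bernoulliPolynomialSeries_eq_mul_rescale_exp, bernoulliPolynomialSeries_eq_mul_rescale_exp,
    mul_assoc, PowerSeries.exp_mul_exp_eq_exp_add]

theorem aeval_add_bernoulli (x y : A) (n : ℕ) :
    Polynomial.aeval (x + y) (Polynomial.bernoulli n) =
      ∑ j ∈ range (n + 1),
        (n.choose j : A) * Polynomial.aeval x (Polynomial.bernoulli j) * y ^ (n - j) := by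
  rw [← factorial_mul_coeff_bernoulliPolynomialSeries, bernoulliPolynomialSeries_add,
    PowerSeries.coeff_mul, Nat.sum_antidiagonal_eq_sum_range_succ_mk, mul_sum]
  refine sum_congr rfl fun j hj => ?_
  have hfac : ((n - j)! : A) * algebraMap ℚ A (1 / (n - j)!) = 1 := by
    rw [← map_natCast (algebraMap ℚ A), ← map_mul,
      mul_one_div_cancel (Nat.cast_ne_zero.2 (n - j).factorial_ne_zero), map_one]
  have hchoose : (n ! : A) = n.choose j * j ! * (n - j)! := by
    rw [← Nat.choose_mul_factorial_mul_factorial (mem_range_succ_iff.1 hj), Nat.cast_mul,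
      Nat.cast_mul]
  rw [PowerSeries.coeff_rescale, PowerSeries.coeff_exp, hchoose,
    ← factorial_mul_coeff_bernoulliPolynomialSeries]
  linear_combination (n.choose j : A) * j ! *
    (bernoulliPolynomialSeries x).coeff j * y ^ (n - j) * hfac

theorem sum_rescale_bernoulliPolynomialSeries {K : Type*} [Field K] [Algebra ℚ K] {m : ℕ}
    (hm : (m : K) ≠ 0) (x : K) :
    ∑ a ∈ range m, PowerSeries.rescale (m : K) (bernoulliPolynomialSeries (x + a / m)) =
      PowerSeries.C (m : K) * bernoulliPolynomialSeries (m * x) := by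
  set E := PowerSeries.exp K
  have hterm (a : ℕ) : PowerSeries.rescale (m : K) (bernoulliPolynomialSeries (x + a / m)) =
      PowerSeries.rescale (m : K) (bernoulliPowerSeries K) *
        PowerSeries.rescale (m * x) E * E ^ a := by
    rw [bernoulliPolynomialSeries_eq_mul_rescale_exp, map_mul, PowerSeries.rescale_rescale, add_mul,
      div_mul_cancel₀ _ hm, ← PowerSeries.exp_mul_exp_eq_exp_add,
      ← PowerSeries.exp_pow_eq_rescale_exp, mul_comm x, mul_assoc]
  have hgeom : (∑ a ∈ range m, E ^ a) * (E - 1) = PowerSeries.rescale (m : K) (E - 1) := by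
    rw [geom_sum_mul, PowerSeries.exp_pow_eq_rescale_exp, map_sub, map_one]
  have hbern : PowerSeries.rescale (m : K) (bernoulliPowerSeries K) *
      PowerSeries.rescale (m : K) (E - 1) = PowerSeries.C (m : K) * PowerSeries.X := by
    rw [← map_mul, bernoulliPowerSeries_mul_exp_sub_one, PowerSeries.rescale_X]
  apply exp_sub_one_mul_right_cancel
  rw [sum_congr rfl fun a _ => hterm a, ← mul_sum,
    bernoulliPolynomialSeries_eq_mul_rescale_exp]
  linear_combination PowerSeries.rescale (m : K) (bernoulliPowerSeries K) *
      PowerSeries.rescale (m * x) E * hgeom + PowerSeries.rescale (m * x) E * hbern -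
    PowerSeries.C (m : K) * PowerSeries.rescale (m * x) E *
      bernoulliPowerSeries_mul_exp_sub_one (A := K)

theorem sum_pow_mul_aeval_bernoulli {K : Type*} [Field K] [Algebra ℚ K] {m : ℕ}
    (hm : (m : K) ≠ 0) (n : ℕ) (x : K) :
    ∑ a ∈ range m, (m : K) ^ n * Polynomial.aeval (x + a / m) (Polynomial.bernoulli n) =
      m * Polynomial.aeval (m * x) (Polynomial.bernoulli n) := by
  have h := congrArg (fun f => (n ! : K) * f.coeff n) (sum_rescale_bernoulliPolynomialSeries hm x)
  simpa only [map_sum, mul_sum, PowerSeries.coeff_rescale, PowerSeries.coeff_C_mul,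
    mul_left_comm (n ! : K), factorial_mul_coeff_bernoulliPolynomialSeries] using h

theorem aeval_zero_bernoulli (n : ℕ) :
    Polynomial.aeval (0 : A) (Polynomial.bernoulli n) = algebraMap ℚ A (bernoulli n) := by
  rw [← map_zero (algebraMap ℚ A), Polynomial.aeval_algebraMap_apply,
    Polynomial.coe_aeval_eq_eval, Polynomial.bernoulli_eval_zero]

end BernoulliPolynomials

section NewtonSeries

variable {R : Type*} [CommRing R]

theorem coeff_descPochhammer_eq_zero_of_lt {i j : ℕ} (h : j < i) :
    (descPochhammer R j).coeff i = 0 := by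
  rw [← descPochhammer_map (Int.castRingHom R), Polynomial.coeff_map,
    Polynomial.coeff_eq_zero_of_natDegree_lt (by rwa [descPochhammer_natDegree]), map_zero]

variable [TopologicalSpace R]

/-- The coefficient of `Xⁱ` in the Newton series `∑ dⱼ X (X - 1) ⋯ (X - j + 1)`, obtained by
rearranging it into a power series; it is meaningful when `dⱼ → 0`. -/
noncomputable def newtonCoeff (d : ℕ → R) (i : ℕ) : R :=
  ∑' j, d j * (descPochhammer R j).coeff i

theorem newtonCoeff_zero (d : ℕ → R) : newtonCoeff d 0 = d 0 := by
  rw [newtonCoeff, tsum_eq_single 0]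
  · simp
  · intro j hj
    rw [Polynomial.coeff_zero_eq_eval_zero, descPochhammer_ne_zero_eval_zero R hj, mul_zero]

end NewtonSeries

section Ultrametric

theorem norm_tsum_le_of_forall_le_of_nonneg {ι E : Type*} [SeminormedAddCommGroup E]
    [IsUltrametricDist E] {f : ι → E} {C : ℝ} (hC : 0 ≤ C) (h : ∀ i, ‖f i‖ ≤ C) :
    ‖∑' i, f i‖ ≤ C := by
  by_cases hf : Summable f
  · exact le_of_tendsto hf.hasSum.norm <| .of_forall fun s =>
      IsUltrametricDist.norm_sum_le_of_forall_le_of_nonneg hC fun i _ => h i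
  · rwa [tsum_eq_zero_of_not_summable hf, norm_zero]

variable {R : Type*} [NormedCommRing R] [NormOneClass R] [IsUltrametricDist R]

section PolynomialSeries

variable [CompleteSpace R] {ι : Type*} {P : ι → R[X]} {b : ι → ℝ} {x : R}

theorem summable_coeff_mul_pow (hP : ∀ j i, ‖(P j).coeff i‖ ≤ b j)
    (hb : Tendsto b cofinite (𝓝 0)) (hx : ‖x‖ ≤ 1) :
    Summable fun q : ι × ℕ => (P q.1).coeff q.2 * x ^ q.2 := by
  apply NonarchimedeanAddGroup.summable_of_tendsto_cofinite_zero
  refine Metric.tendsto_nhds.2 fun ε hε => ?_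
  have hfin : {j | ε ≤ b j}.Finite := by
    simpa only [eventually_cofinite, not_lt] using hb.eventually_lt_const hε
  refine (hfin.biUnion fun j _ => (P j).support.finite_toSet.image (Prod.mk j)).subset ?_
  rintro ⟨j, i⟩ hji
  have hji : ε ≤ ‖(P j).coeff i * x ^ i‖ := by simpa using hji
  have hbj : ε ≤ b j := calc
    ε ≤ ‖(P j).coeff i‖ * ‖x ^ i‖ := hji.trans (norm_mul_le _ _)
    _ ≤ ‖(P j).coeff i‖ := mul_le_of_le_one_right (norm_nonneg _)
      ((norm_pow_le _ _).trans (pow_le_one₀ (norm_nonneg _) hx))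
    _ ≤ b j := hP j i
  have hcoeff : (P j).coeff i ≠ 0 := by
    intro h
    rw [h, zero_mul, norm_zero] at hji
    exact hji.not_gt hε
  exact Set.mem_biUnion hbj ⟨i, Polynomial.mem_support_iff.2 hcoeff, rfl⟩

theorem hasSum_tsum_coeff_mul_pow (hP : ∀ j i, ‖(P j).coeff i‖ ≤ b j)
    (hb : Tendsto b cofinite (𝓝 0)) (hx : ‖x‖ ≤ 1) :
    HasSum (fun i => (∑' j, (P j).coeff i) * x ^ i) (∑' j, (P j).eval x) := by
  have hsum := summable_coeff_mul_pow hP hb hx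
  have hcol (i : ℕ) : Summable fun j => (P j).coeff i := by
    have hone := summable_coeff_mul_pow hP hb (norm_one (α := R)).le
    simpa [Function.comp_def] using hone.comp_injective (Prod.mk_left_injective i)
  have hrow (j : ι) : HasSum (fun i => (P j).coeff i * x ^ i) ((P j).eval x) := by
    rw [Polynomial.eval_eq_sum, Polynomial.sum]
    exact hasSum_sum_of_ne_finset_zero fun i hi => by
      rw [Polynomial.notMem_support_iff.1 hi, zero_mul]
  have htotal := hsum.hasSum
  rw [← (htotal.prod_fiberwise hrow).tsum_eq] at htotal
  exact ((Equiv.prodComm ℕ ι).hasSum_iff.2 htotal).prod_fiberwise fun i =>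
    (hcol i).hasSum.mul_right _

end PolynomialSeries

theorem norm_coeff_descPochhammer_le_one (j i : ℕ) : ‖(descPochhammer R j).coeff i‖ ≤ 1 := by
  rw [← descPochhammer_map (Int.castRingHom R), Polynomial.coeff_map, eq_intCast]
  exact IsUltrametricDist.norm_intCast_le_one R _

theorem norm_newtonCoeff_le {d : ℕ → R} {i : ℕ} {C : ℝ} (hC : 0 ≤ C)
    (h : ∀ j, i ≤ j → ‖d j‖ ≤ C) : ‖newtonCoeff d i‖ ≤ C := by
  refine norm_tsum_le_of_forall_le_of_nonneg hC fun j => ?_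
  rcases lt_or_ge j i with hj | hj
  · rwa [coeff_descPochhammer_eq_zero_of_lt hj, mul_zero, norm_zero]
  · calc
      _ ≤ ‖d j‖ * ‖(descPochhammer R j).coeff i‖ := norm_mul_le _ _
      _ ≤ ‖d j‖ := mul_le_of_le_one_right (norm_nonneg _) (norm_coeff_descPochhammer_le_one j i)
      _ ≤ C := h j hj

theorem hasSum_newtonCoeff_mul_pow [CompleteSpace R] {d : ℕ → R} (hd : Tendsto d atTop (𝓝 0))
    {x : R} (hx : ‖x‖ ≤ 1) :
    HasSum (fun i => newtonCoeff d i * x ^ i) (∑' j, d j * (descPochhammer R j).eval x) := by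
  have hcoeff (j i : ℕ) : ‖(Polynomial.C (d j) * descPochhammer R j).coeff i‖ ≤ ‖d j‖ := by
    rw [Polynomial.coeff_C_mul]
    exact (norm_mul_le _ _).trans
      (mul_le_of_le_one_right (norm_nonneg _) (norm_coeff_descPochhammer_le_one j i))
  simpa only [newtonCoeff, Polynomial.coeff_C_mul, Polynomial.eval_mul, Polynomial.eval_C] using
    hasSum_tsum_coeff_mul_pow hcoeff
      (Nat.cofinite_eq_atTop ▸ tendsto_zero_iff_norm_tendsto_zero.1 hd) hx

theorem hasSum_newtonCoeff_mul_natCast_pow [CompleteSpace R] {d : ℕ → R}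
    (hd : Tendsto d atTop (𝓝 0)) (n : ℕ) :
    HasSum (fun i => newtonCoeff d i * (n : R) ^ i)
      (∑ j ∈ range (n + 1), d j * (n.descFactorial j : R)) := by
  have h := hasSum_newtonCoeff_mul_pow hd (IsUltrametricDist.norm_natCast_le_one R n)
  rw [tsum_eq_sum (s := range (n + 1))] at h
  · simpa only [descPochhammer_eval_eq_descFactorial] using h
  · intro j hj
    rw [descPochhammer_eval_eq_descFactorial,
      Nat.descFactorial_of_lt (Nat.lt_of_succ_le (by simpa using hj)), Nat.cast_zero, mul_zero]

end Ultrametric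

section Padic

variable {p : ℕ} [Fact p.Prime]

theorem norm_inv_natCast_prime {q : ℕ} (hq : q.Prime) :
    ‖(q : ℚ_[p])⁻¹‖ = if q = p then (p : ℝ) else 1 := by
  split_ifs with hqp
  · rw [hqp, norm_inv, Padic.norm_p, inv_inv]
  · rw [norm_inv, Padic.norm_natCast_eq_one_iff.2
      ((Nat.coprime_primes Fact.out hq).2 (Ne.symm hqp)), inv_one]

theorem norm_bernoulli_le_of_forall_prime {C : ℝ} (hC : 1 ≤ C) (n : ℕ)
    (h : ∀ q, q.Prime → q ≤ n + 1 → ‖(q : ℚ_[p])⁻¹‖ ≤ C) :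
    ‖((bernoulli n : ℚ) : ℚ_[p])‖ ≤ C := by
  rcases Nat.even_or_odd' n with ⟨k, rfl | rfl⟩
  · obtain ⟨z, hz⟩ := Bernoulli.vonStaudt_clausen k
    rw [eq_sub_of_add_eq hz.symm, Rat.cast_sub, Rat.cast_intCast, Rat.cast_sum, sub_eq_add_neg]
    refine (IsUltrametricDist.norm_add_le_max _ _).trans
      (max_le ((Padic.norm_int_le_one z).trans hC) ?_)
    rw [norm_neg]
    refine IsUltrametricDist.norm_sum_le_of_forall_le_of_nonneg (zero_le_one.trans hC)
      fun q hq => ?_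
    rw [mem_filter, mem_range] at hq
    simpa using h q hq.2.1 (Nat.le_of_lt_succ hq.1)
  · rcases eq_or_ne k 0 with rfl | hk
    · simpa [neg_div] using h 2 Nat.prime_two le_rfl
    · rw [bernoulli_eq_zero_of_odd (odd_two_mul_add_one k) (by lia), Rat.cast_zero, norm_zero]
      exact zero_le_one.trans hC

theorem norm_bernoulli_le_prime (n : ℕ) : ‖((bernoulli n : ℚ) : ℚ_[p])‖ ≤ p := by
  have hp1 : (1 : ℝ) ≤ p := mod_cast (Fact.out : p.Prime).one_le
  refine norm_bernoulli_le_of_forall_prime hp1 n fun q hq _ => ?_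
  rw [norm_inv_natCast_prime hq]
  split_ifs <;> simp [hp1]

theorem norm_bernoulli_le_one {n : ℕ} (hn : n + 1 < p) : ‖((bernoulli n : ℚ) : ℚ_[p])‖ ≤ 1 :=
  norm_bernoulli_le_of_forall_prime le_rfl n fun q hq hqn => by
    rw [norm_inv_natCast_prime hq, if_neg (hqn.trans_lt hn).ne]

theorem norm_aeval_bernoulli_le {C : ℝ} {n : ℕ}
    (h : ∀ m ≤ n, ‖((bernoulli m : ℚ) : ℚ_[p])‖ ≤ C) {t : ℚ_[p]} (ht : ‖t‖ ≤ 1) :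
    ‖Polynomial.aeval t (Polynomial.bernoulli n)‖ ≤ C := by
  have hC : 0 ≤ C := (norm_nonneg _).trans (h n le_rfl)
  rw [Polynomial.bernoulli_def, map_sum]
  refine IsUltrametricDist.norm_sum_le_of_forall_le_of_nonneg hC fun i _ => ?_
  rw [Polynomial.aeval_monomial, eq_ratCast, Rat.cast_mul, Rat.cast_natCast, norm_mul, norm_mul,
    norm_pow]
  calc
    _ ≤ C * 1 * 1 := by
      gcongr
      · exact h _ (Nat.sub_le n i)
      · exact IsUltrametricDist.norm_natCast_le_one ℚ_[p] _
      · exact pow_le_one₀ (norm_nonneg _) ht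
    _ = C := by rw [mul_one, mul_one]

theorem le_valuation_of_norm_le_rpow {x : ℚ_[p]} (hx : x ≠ 0) {c : ℝ}
    (h : ‖x‖ ≤ (p : ℝ) ^ (-c)) : c ≤ x.valuation := by
  have hp1 : (1 : ℝ) < p := mod_cast (Fact.out : p.Prime).one_lt
  rw [Padic.norm_eq_zpow_neg_valuation hx, ← Real.rpow_intCast, Real.rpow_le_rpow_left_iff hp1,
    Int.cast_neg] at h
  exact neg_le_neg_iff.1 h

theorem one_sub_p_zpow_ne_zero {m : ℤ} (hm : m ≠ 0) : 1 - (p : ℚ_[p]) ^ m ≠ 0 := by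
  have hp : p.Prime := Fact.out
  intro h
  have hnorm : ‖(p : ℚ_[p]) ^ m‖ = 1 := by rw [← sub_eq_zero.1 h, norm_one]
  rw [Padic.norm_p_zpow, zpow_eq_one_iff_right₀ p.cast_nonneg (mod_cast hp.ne_one)] at hnorm
  exact hm (neg_eq_zero.1 hnorm)

theorem norm_natCast_eq_rpow_neg_padicValNat {n : ℕ} (hn : n ≠ 0) :
    ‖(n : ℚ_[p])‖ = (p : ℝ) ^ (-(padicValNat p n : ℝ)) := by
  rw [Padic.norm_eq_zpow_neg_valuation (Nat.cast_ne_zero.2 hn), Padic.valuation_natCast,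
    ← Real.rpow_intCast, Int.cast_neg, Int.cast_natCast]

theorem div_mul_le_sub_padicValNat_factorial (j : ℕ) :
    ((p : ℝ) - 2) / (p - 1) * j ≤ j - padicValNat p j ! := by
  have hp1 : (0 : ℝ) < p - 1 := sub_pos.2 (mod_cast (Fact.out : p.Prime).one_lt)
  have hlegendre : ((p : ℝ) - 1) * padicValNat p j ! ≤ j := by
    have h := (sub_one_mul_padicValNat_factorial (p := p) j).trans_le (Nat.sub_le _ _)
    rw [← Nat.cast_pred (Fact.out : p.Prime).pos]
    exact_mod_cast h
  rw [div_mul_eq_mul_div, div_le_iff₀ hp1]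
  linarith

theorem padicValNat_factorial_add_sub_one_le {j : ℕ} (h : p - 1 ≤ j) :
    padicValNat p j ! + (p - 1) ≤ j := by
  have hp2 : 2 ≤ p := (Fact.out : p.Prime).two_le
  rcases Nat.eq_zero_or_pos (padicValNat p j !) with hv | hv
  · rwa [hv, zero_add]
  · have hlegendre : (p - 1) * padicValNat p j ! < j :=
      sub_one_mul_padicValNat_factorial_lt_of_ne_zero p (by lia)
    have hmul : padicValNat p j ! + (p - 1) - 1 ≤ padicValNat p j ! * (p - 1) :=
      Nat.add_sub_one_le_mul hv.ne' (by lia)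
    lia

end Padic

section Teichmuller

variable {p : ℕ} [Fact p.Prime]

theorem ringHom_eq_toZMod (f : ℤ_[p] →+* ZMod p) : f = PadicInt.toZMod := by
  ext x
  have hx := PadicInt.sub_zmodRepr_mem x
  rw [PadicInt.maximalIdeal_eq_span_p, Ideal.mem_span_singleton] at hx
  obtain ⟨y, hy⟩ := hx
  rw [eq_add_of_sub_eq hy]
  simp

variable (p) in
/-- The Teichmüller character `ω`, sending a residue class to the `(p - 1)`-st root of unity
lifting it; its values are taken from the Teichmüller representatives in `𝕎 (ZMod p) ≃+* ℤ_[p]`. -/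
noncomputable def teichmullerCharacter : (ZMod p)ˣ →* ℤ_[p]ˣ :=
  Units.map <| (WittVector.equiv p : WittVector p (ZMod p) →* ℤ_[p]).comp (WittVector.teichmuller p)

theorem toZMod_teichmullerCharacter (u : (ZMod p)ˣ) :
    PadicInt.toZMod (teichmullerCharacter p u : ℤ_[p]) = u := by
  rw [← ringHom_eq_toZMod
    (WittVector.constantCoeff.comp ((WittVector.equiv p).symm : ℤ_[p] →+* WittVector p (ZMod p)))]
  simp [teichmullerCharacter, WittVector.constantCoeff]

theorem teichmullerCharacter_injective : Function.Injective (teichmullerCharacter p) := by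
  intro u v h
  ext
  rw [← toZMod_teichmullerCharacter u, h, toZMod_teichmullerCharacter]

theorem teichmullerCharacter_pow_eq_one_iff (k : ℕ) :
    teichmullerCharacter p ^ k = 1 ↔ p - 1 ∣ k := by
  rw [← ZMod.card_units p, ← Nat.card_eq_fintype_card, ← IsCyclic.exponent_eq_card,
    Monoid.exponent_dvd_iff_forall_pow_eq_one, MonoidHom.ext_iff]
  refine forall_congr' fun u => ?_
  rw [MonoidHom.pow_apply, ← map_pow, MonoidHom.one_apply,
    (injective_iff_map_eq_one' _).1 teichmullerCharacter_injective]

theorem sum_teichmullerCharacter_pow (k : ℕ) :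
    ∑ u, (teichmullerCharacter p u : ℤ_[p]) ^ k = if p - 1 ∣ k then (p : ℤ_[p]) - 1 else 0 := by
  classical
  have h := sum_hom_units ((Units.coeHom ℤ_[p]).comp (teichmullerCharacter p ^ k))
  have htriv : (Units.coeHom ℤ_[p]).comp (teichmullerCharacter p ^ k) = 1 ↔ p - 1 ∣ k := by
    rw [← teichmullerCharacter_pow_eq_one_iff,
      ← MonoidHom.cancel_left (g := Units.coeHom ℤ_[p]) Units.val_injective, MonoidHom.comp_one]
  simpa [htriv, Nat.totient_prime Fact.out, Nat.cast_pred (Fact.out : p.Prime).pos, apply_ite]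
    using h

/-- The quotient `t(a) = (a - ω(a)) / p`, where `0 < a < p` represents the residue class; it is
a `p`-adic integer. -/
noncomputable def teichmullerQuotient (u : (ZMod p)ˣ) : ℚ_[p] :=
  ((u : ZMod p).val - ((teichmullerCharacter p u : ℤ_[p]) : ℚ_[p])) / p

theorem val_div_eq_teichmullerQuotient_add (u : (ZMod p)ˣ) :
    ((u : ZMod p).val : ℚ_[p]) / p =
      teichmullerQuotient u + ((teichmullerCharacter p u : ℤ_[p]) : ℚ_[p]) / p := by
  rw [teichmullerQuotient, ← add_div, sub_add_cancel]

theorem norm_teichmullerQuotient_le_one (u : (ZMod p)ˣ) : ‖teichmullerQuotient u‖ ≤ 1 := by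
  have hker : ((u : ZMod p).val : ℤ_[p]) - teichmullerCharacter p u ∈
      RingHom.ker (PadicInt.toZMod (p := p)) := by
    rw [RingHom.mem_ker, map_sub, toZMod_teichmullerCharacter, map_natCast, ZMod.natCast_zmod_val,
      sub_self]
  rw [PadicInt.ker_toZMod, PadicInt.maximalIdeal_eq_span_p, Ideal.mem_span_singleton] at hker
  obtain ⟨t, ht⟩ := hker
  have hp0 : (p : ℚ_[p]) ≠ 0 := Nat.cast_ne_zero.2 (Fact.out : p.Prime).ne_zero
  have heq : teichmullerQuotient u = t := by
    rw [teichmullerQuotient, div_eq_iff hp0, mul_comm]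
    exact_mod_cast congrArg ((↑) : ℤ_[p] → ℚ_[p]) ht
  exact heq ▸ t.norm_le_one

theorem sum_range_eq_add_sum_units {M : Type*} [AddCommMonoid M] (f : ℕ → M) :
    ∑ a ∈ range p, f a = f 0 + ∑ u : (ZMod p)ˣ, f (u : ZMod p).val := by
  rw [range_eq_Ico, sum_eq_sum_Ico_succ_bot (Fact.out : p.Prime).pos]
  congr 1
  symm
  refine sum_bij (fun u _ => (u : ZMod p).val) (fun u _ => mem_Ico.2 ⟨?_, ZMod.val_lt _⟩)
    (fun u _ v _ h => Units.ext (ZMod.val_injective p h)) (fun a ha => ?_) fun _ _ => rfl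
  · exact Nat.pos_of_ne_zero ((ZMod.val_ne_zero _).2 u.ne_zero)
  · obtain ⟨hpos, hlt⟩ := mem_Ico.1 ha
    have ha0 : (a : ZMod p) ≠ 0 :=
      mt (ZMod.natCast_eq_zero_iff a p).1 (Nat.not_dvd_of_pos_of_lt hpos hlt)
    exact ⟨Units.mk0 a ha0, mem_univ _, ZMod.val_cast_of_lt hlt⟩

end Teichmuller

section BernoulliCoefficients

variable (p : ℕ) [Fact p.Prime]

/-- The character sum `∑ ω(u)ᵏ⁻ʲ Bⱼ(t(u))` of the values of the `j`-th Bernoulli polynomial at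
the quotients `t(u) = (u - ω(u)) / p`. -/
noncomputable def twistedBernoulliSum (k j : ℕ) : ℚ_[p] :=
  ∑ u, (((teichmullerCharacter p u ^ (k - j : ℤ) : ℤ_[p]ˣ) : ℤ_[p]) : ℚ_[p]) *
    Polynomial.aeval (teichmullerQuotient u) (Polynomial.bernoulli j)

/-- The coefficient of `X (X - 1) ⋯ (X - j + 1)` in the Newton series of the function
`n ↦ (1 - pⁿ⁻¹) Bₙ` on the residue class of `k` modulo `p - 1`. -/
noncomputable def bernoulliNewtonCoeff (k j : ℕ) : ℚ_[p] :=
  (p : ℚ_[p]) ^ j * twistedBernoulliSum p k j / (p * j !)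

/-- The coefficient `aᵢ(p, k)` of the power series for `n ↦ (1 - pⁿ⁻¹) Bₙ` on the residue class
of `k` modulo `p - 1`. -/
noncomputable def bernoulliPowerCoeff (k i : ℕ) : ℚ_[p] :=
  newtonCoeff (bernoulliNewtonCoeff p k) i

variable {p}

theorem pow_mul_aeval_val_div_bernoulli {k n : ℕ} (hn : n ≡ k [MOD p - 1]) (u : (ZMod p)ˣ) :
    (p : ℚ_[p]) ^ n * Polynomial.aeval ((u : ZMod p).val / (p : ℚ_[p])) (Polynomial.bernoulli n) =
      ∑ j ∈ range (n + 1), (n.choose j : ℚ_[p]) * (p : ℚ_[p]) ^ j *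
        ((((teichmullerCharacter p u ^ (k - j : ℤ) : ℤ_[p]ˣ) : ℤ_[p]) : ℚ_[p]) *
          Polynomial.aeval (teichmullerQuotient u) (Polynomial.bernoulli j)) := by
  have hp0 : (p : ℚ_[p]) ≠ 0 := Nat.cast_ne_zero.2 (Fact.out : p.Prime).ne_zero
  have hω : teichmullerCharacter p u ^ n = teichmullerCharacter p u ^ k :=
    pow_eq_pow_of_modEq hn <| by rw [← map_pow, ZMod.units_pow_card_sub_one_eq_one, map_one]
  rw [val_div_eq_teichmullerQuotient_add, aeval_add_bernoulli, mul_sum]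
  refine sum_congr rfl fun j hj => ?_
  have hj : j ≤ n := mem_range_succ_iff.1 hj
  have hωj : teichmullerCharacter p u ^ (k - j : ℤ) = teichmullerCharacter p u ^ (n - j) := by
    rw [zpow_sub, zpow_natCast, zpow_natCast, ← hω, ← div_eq_mul_inv, pow_sub _ hj]
    rfl
  have hpj : (p : ℚ_[p]) ^ n = p ^ j * p ^ (n - j) := by rw [← pow_add, Nat.add_sub_cancel' hj]
  rw [hωj, hpj, Units.val_pow_eq_pow_val, PadicInt.coe_pow, div_pow]
  field_simp

theorem euler_factor_mul_bernoulli {k n : ℕ} (hn : n ≡ k [MOD p - 1]) :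
    (1 - (p : ℚ_[p]) ^ ((n : ℤ) - 1)) * ((bernoulli n : ℚ) : ℚ_[p]) =
      ∑ j ∈ range (n + 1), bernoulliNewtonCoeff p k j * (n.descFactorial j : ℚ_[p]) := by
  have hp0 : (p : ℚ_[p]) ≠ 0 := Nat.cast_ne_zero.2 (Fact.out : p.Prime).ne_zero
  have hmult := sum_pow_mul_aeval_bernoulli hp0 n 0
  simp only [zero_add, mul_zero, sum_range_eq_add_sum_units, Nat.cast_zero, zero_div,
    aeval_zero_bernoulli, eq_ratCast] at hmult
  simp only [pow_mul_aeval_val_div_bernoulli hn] at hmult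
  rw [sum_comm] at hmult
  simp only [← mul_sum] at hmult
  have hterm (j : ℕ) : p * (bernoulliNewtonCoeff p k j * (n.descFactorial j : ℚ_[p])) =
      n.choose j * p ^ j * twistedBernoulliSum p k j := by
    have hj : (j ! : ℚ_[p]) ≠ 0 := Nat.cast_ne_zero.2 j.factorial_ne_zero
    rw [bernoulliNewtonCoeff, Nat.descFactorial_eq_factorial_mul_choose, Nat.cast_mul]
    field_simp
  apply mul_left_cancel₀ hp0
  simp only [mul_sum, hterm]
  simp only [twistedBernoulliSum]
  have hp1 : p * (p : ℚ_[p]) ^ ((n : ℤ) - 1) = p ^ n := by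
    rw [zpow_sub_one₀ hp0, zpow_natCast, mul_comm, inv_mul_cancel_right₀ hp0]
  linear_combination -hmult - ((bernoulli n : ℚ) : ℚ_[p]) * hp1

theorem bernoulliNewtonCoeff_zero (k : ℕ) :
    bernoulliNewtonCoeff p k 0 = if p - 1 ∣ k then 1 - 1 / (p : ℚ_[p]) else 0 := by
  have hp0 : (p : ℚ_[p]) ≠ 0 := Nat.cast_ne_zero.2 (Fact.out : p.Prime).ne_zero
  have hsum : twistedBernoulliSum p k 0 = if p - 1 ∣ k then (p : ℚ_[p]) - 1 else 0 := by
    have h := congrArg ((↑) : ℤ_[p] → ℚ_[p]) (sum_teichmullerCharacter_pow (p := p) k)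
    split_ifs at h ⊢ <;> simpa [twistedBernoulliSum] using h
  rw [bernoulliNewtonCoeff, hsum, pow_zero, one_mul, Nat.factorial_zero, Nat.cast_one, mul_one,
    ite_div, zero_div, sub_div, div_self hp0]

theorem norm_twistedBernoulliSum_le {C : ℝ} {j : ℕ}
    (h : ∀ m ≤ j, ‖((bernoulli m : ℚ) : ℚ_[p])‖ ≤ C) (k : ℕ) :
    ‖twistedBernoulliSum p k j‖ ≤ C := by
  have hC : 0 ≤ C := (norm_nonneg _).trans (h j le_rfl)
  refine IsUltrametricDist.norm_sum_le_of_forall_le_of_nonneg hC fun u _ => ?_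
  rw [norm_mul, ← PadicInt.norm_def, PadicInt.norm_units, one_mul]
  exact norm_aeval_bernoulli_le h (norm_teichmullerQuotient_le_one u)

theorem norm_bernoulliNewtonCoeff (k j : ℕ) :
    ‖bernoulliNewtonCoeff p k j‖ =
      (p : ℝ) ^ (1 + padicValNat p j ! - j : ℝ) * ‖twistedBernoulliSum p k j‖ := by
  have hp0 : (0 : ℝ) < p := mod_cast (Fact.out : p.Prime).pos
  rw [bernoulliNewtonCoeff, norm_div, norm_mul, norm_mul, norm_pow, Padic.norm_p,
    norm_natCast_eq_rpow_neg_padicValNat j.factorial_ne_zero, Real.rpow_sub hp0,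
    Real.rpow_add hp0, Real.rpow_one, Real.rpow_neg hp0.le, Real.rpow_natCast p j, inv_pow]
  field_simp

theorem norm_bernoulliNewtonCoeff_le (k j : ℕ) :
    ‖bernoulliNewtonCoeff p k j‖ ≤ (p : ℝ) ^ (2 + padicValNat p j ! - j : ℝ) := by
  have hp0 : (0 : ℝ) < p := mod_cast (Fact.out : p.Prime).pos
  calc
    _ ≤ (p : ℝ) ^ (1 + padicValNat p j ! - j : ℝ) * p := by
      rw [norm_bernoulliNewtonCoeff]
      gcongr
      exact norm_twistedBernoulliSum_le (fun m _ => norm_bernoulli_le_prime m) k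
    _ = _ := by
      rw [← Real.rpow_add_one hp0.ne']
      ring_nf

theorem norm_bernoulliNewtonCoeff_le_of_lt (k : ℕ) {j : ℕ} (hj : j + 1 < p) :
    ‖bernoulliNewtonCoeff p k j‖ ≤ (p : ℝ) ^ (1 - j : ℝ) := by
  have hv : padicValNat p j ! = 0 := padicValNat.eq_zero_of_not_dvd <| by
    rw [(Fact.out : p.Prime).dvd_factorial]
    lia
  rw [norm_bernoulliNewtonCoeff, hv, Nat.cast_zero, add_zero]
  exact mul_le_of_le_one_right (by positivity)
    (norm_twistedBernoulliSum_le (fun m hm => norm_bernoulli_le_one (by lia)) k)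

theorem norm_bernoulliNewtonCoeff_le_rpow (k j : ℕ) :
    ‖bernoulliNewtonCoeff p k j‖ ≤ (p : ℝ) ^ (2 - ((p : ℝ) - 2) / (p - 1) * j) := by
  refine (norm_bernoulliNewtonCoeff_le k j).trans
    (Real.rpow_le_rpow_of_exponent_le (mod_cast (Fact.out : p.Prime).one_le) ?_)
  linarith [div_mul_le_sub_padicValNat_factorial (p := p) j]

theorem tendsto_bernoulliNewtonCoeff (hp : p ≠ 2) (k : ℕ) :
    Tendsto (bernoulliNewtonCoeff p k) atTop (𝓝 0) := by
  have hp1 : (1 : ℝ) < p := mod_cast (Fact.out : p.Prime).one_lt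
  have hp2 : (2 : ℝ) < p := mod_cast (Fact.out : p.Prime).two_le.lt_of_ne' hp
  have hslope : 0 < ((p : ℝ) - 2) / (p - 1) := div_pos (sub_pos.2 hp2) (sub_pos.2 hp1)
  refine squeeze_zero_norm (norm_bernoulliNewtonCoeff_le_rpow k) ?_
  refine (tendsto_rpow_atBot_of_base_gt_one _ hp1).comp ?_
  exact tendsto_atBot_add_const_left _ 2 <| tendsto_neg_atTop_atBot.comp <|
    tendsto_natCast_atTop_atTop.const_mul_atTop hslope

theorem hasSum_bernoulliPowerCoeff_mul_pow (hp : p ≠ 2) {k n : ℕ} (hn : n ≡ k [MOD p - 1]) :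
    HasSum (fun i => bernoulliPowerCoeff p k i * (n : ℚ_[p]) ^ i)
      ((1 - (p : ℚ_[p]) ^ ((n : ℤ) - 1)) * ((bernoulli n : ℚ) : ℚ_[p])) := by
  rw [euler_factor_mul_bernoulli hn]
  exact hasSum_newtonCoeff_mul_natCast_pow (tendsto_bernoulliNewtonCoeff hp k) n

theorem bernoulliPowerCoeff_zero (k : ℕ) :
    bernoulliPowerCoeff p k 0 = if p - 1 ∣ k then 1 - 1 / (p : ℚ_[p]) else 0 := by
  rw [bernoulliPowerCoeff, newtonCoeff_zero, bernoulliNewtonCoeff_zero]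

theorem div_mul_sub_two_le_valuation_bernoulliPowerCoeff {k i : ℕ}
    (hi : bernoulliPowerCoeff p k i ≠ 0) :
    ((p : ℚ) - 2) / (p - 1) * i - 2 ≤ (bernoulliPowerCoeff p k i).valuation := by
  have hp2 : (2 : ℝ) ≤ p := mod_cast (Fact.out : p.Prime).two_le
  have hslope : 0 ≤ ((p : ℝ) - 2) / (p - 1) := div_nonneg (by linarith) (by linarith)
  have h : ((p : ℝ) - 2) / (p - 1) * i - 2 ≤ (bernoulliPowerCoeff p k i).valuation := by
    refine le_valuation_of_norm_le_rpow hi (norm_newtonCoeff_le (by positivity) fun j hij => ?_)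
    refine (norm_bernoulliNewtonCoeff_le_rpow k j).trans
      (Real.rpow_le_rpow_of_exponent_le (by linarith) ?_)
    rw [neg_sub]
    gcongr
  exact_mod_cast h

theorem sub_one_le_valuation_bernoulliPowerCoeff {k i : ℕ} (hip : i + 2 ≤ p)
    (hi : bernoulliPowerCoeff p k i ≠ 0) :
    (i : ℤ) - 1 ≤ (bernoulliPowerCoeff p k i).valuation := by
  have hp1 : (1 : ℝ) ≤ p := mod_cast (Fact.out : p.Prime).one_le
  have h : (i : ℝ) - 1 ≤ (bernoulliPowerCoeff p k i).valuation := by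
    refine le_valuation_of_norm_le_rpow hi (norm_newtonCoeff_le (by positivity) fun j hij => ?_)
    rw [neg_sub]
    rcases lt_or_ge (j + 1) p with hj | hj
    · refine (norm_bernoulliNewtonCoeff_le_of_lt k hj).trans
        (Real.rpow_le_rpow_of_exponent_le hp1 ?_)
      gcongr
    · refine (norm_bernoulliNewtonCoeff_le k j).trans (Real.rpow_le_rpow_of_exponent_le hp1 ?_)
      have hv : padicValNat p j ! + (i + 1) ≤ j :=
        (Nat.add_le_add_left (by lia) _).trans
          (padicValNat_factorial_add_sub_one_le (p := p) (by lia))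
      have hv : (padicValNat p j ! : ℝ) + (i + 1) ≤ j := mod_cast hv
      linarith
  exact_mod_cast h

end BernoulliCoefficients

theorem ne_one_of_even_zmod {n : ℕ} (hn : Even n) {k : ZMod n} (hk : Even k) : k ≠ 1 := by
  rintro rfl
  obtain ⟨r, hr⟩ := hk.map (ZMod.castHom hn.two_dvd (ZMod 2))
  rw [map_one, CharTwo.add_self_eq_zero] at hr
  exact one_ne_zero hr

theorem proposition2_general (p : ℕ) [Fact p.Prime] (k : ZMod (p - 1)) (hk : k ≠ 1) :
    ∃ a : ℕ → ℚ_[p],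
      (∀ n : ℕ, (n : ZMod (p - 1)) = k →
        Summable (fun i : ℕ => a i * (n : ℚ_[p]) ^ i) ∧
        ((bernoulli n : ℚ) : ℚ_[p]) =
          (1 - (p : ℚ_[p]) ^ ((n : ℤ) - 1))⁻¹ * ∑' i : ℕ, a i * (n : ℚ_[p]) ^ i) ∧
      a 0 = (if k = 0 then 1 - 1 / (p : ℚ_[p]) else 0) ∧
      (∀ i : ℕ, a i ≠ 0 →
        ((p : ℚ) - 2) / ((p : ℚ) - 1) * (i : ℚ) - 2 ≤ ((a i).valuation : ℚ)) ∧
      (∀ i : ℕ, i + 2 ≤ p → a i ≠ 0 → (i : ℤ) - 1 ≤ (a i).valuation) := by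
  have hp2 : p ≠ 2 := by
    rintro rfl
    exact hk (Subsingleton.elim (α := ZMod 1) _ _)
  have : NeZero (p - 1) := ⟨(Nat.sub_pos_of_lt (Fact.out : p.Prime).one_lt).ne'⟩
  refine ⟨bernoulliPowerCoeff p k.val, fun n hn => ?_, ?_,
    fun i => div_mul_sub_two_le_valuation_bernoulliPowerCoeff,
    fun i => sub_one_le_valuation_bernoulliPowerCoeff⟩
  · have hmod : n ≡ k.val [MOD p - 1] := by
      rw [← ZMod.natCast_eq_natCast_iff, hn, ZMod.natCast_zmod_val]
    have hn1 : (n : ℤ) - 1 ≠ 0 := by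
      rw [sub_ne_zero]
      rintro h
      obtain rfl : n = 1 := mod_cast h
      exact hk (by rw [← hn, Nat.cast_one])
    have hsum := hasSum_bernoulliPowerCoeff_mul_pow hp2 hmod
    exact ⟨hsum.summable, by
      rw [hsum.tsum_eq, inv_mul_cancel_left₀ (one_sub_p_zpow_ne_zero hn1)]⟩
  · simp only [bernoulliPowerCoeff_zero, ← ZMod.natCast_eq_zero_iff, ZMod.natCast_zmod_val]

theorem proposition2 (p : ℕ) [Fact p.Prime] (hp : Odd p) (k : ZMod (p - 1)) (hk : Even k) :
    ∃ a : ℕ → ℚ_[p],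
      (∀ n : ℕ, (n : ZMod (p - 1)) = k →
        Summable (fun i : ℕ => a i * (n : ℚ_[p]) ^ i) ∧
        ((bernoulli n : ℚ) : ℚ_[p]) =
          (1 - (p : ℚ_[p]) ^ ((n : ℤ) - 1))⁻¹ * ∑' i : ℕ, a i * (n : ℚ_[p]) ^ i) ∧
      a 0 = (if k = 0 then 1 - 1 / (p : ℚ_[p]) else 0) ∧
      (∀ i : ℕ, a i ≠ 0 →
        ((p : ℚ) - 2) / ((p : ℚ) - 1) * (i : ℚ) - 2 ≤ ((a i).valuation : ℚ)) ∧
      (∀ i : ℕ, i + 2 ≤ p → a i ≠ 0 → (i : ℤ) - 1 ≤ (a i).valuation) :=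
  proposition2_general p k (ne_one_of_even_zmod (Nat.Odd.sub_odd hp odd_one) hk)
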